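/- Let $E$ be a separable complex Hilbert space, let $\mathbb T$ be the unit circle with normalized Lebesgue measure $m$, and let $\mathbb D$ be the open unit disc. For separable complex Hilbert spaces $D,E$ let $H^\infty(\mathbb T,\mathcal B(D,E))$ be the set of all (essentially) bounded SOT-measurable functions $\Phi:\mathbb T\to\mathcal B(D,E)$ with $\int_{\mathbb T}\overline z^{\,n}\Phi(z)x\,dm(z)=0$ for all $x\in D$ and all integers $n<0$; functions that agree $m$-a.e. are identified, and $\mathcal B(E)=\mathcal B(E,E)$. For $\Phi\in H^\infty(\mathbb T,\mathcal B(E))$ and $\zeta\in\mathbb D$, let $$P[\Phi](\zeta)x=\int_{\mathbb T}\frac{1-|\zeta|^2}{|z-\zeta|^2}\,\Phi(z)x\,dm(z)\qquad(x\in E)$$ be its Poisson integral. A function $\Delta\in H^\infty(\mathbb T,\mathcal B(E))$ is called inner if $\Delta^*\Delta=I_E$ a.e. on $\mathbb T$; an inner $\Delta$ is a left inner divisor of $\Psi$ if $\Psi=\Delta A$ a.e. for some $A\in H^\infty(\mathbb T,\mathcal B(E))$, and it is nontrivial if it is not (a.e. equal to) a constant unitary operator. Two functions are left coprime if they have no common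 nontrivial left inner divisor, and $\Phi,\Psi$ are right coprime if $\widetilde\Phi$ and $\widetilde\Psi$ are left coprime, where $\widetilde\Phi(z)=\Phi(\overline z)^*$. Let $\Phi\in H^\infty(\mathbb T,\mathcal B(E))$ and $\Theta=\theta I_E$, where $\theta(z)=\nu\prod_{i=1}^{n}\frac{z-a_i}{1-\overline{a_i}z}$ ($|\nu|=1$, $n\ge 0$, $|a_i|<1$) is a finite Blaschke product, and let $\mathcal Z(\theta)\subset\mathbb D$ be its set of zeros. Then the following statements are equivalent: (a) $P[\Phi](\alpha)$ is injective for each $\alpha\in\mathcal Z(\theta)$; (b) $\Phi$ and $\Theta$ are right coprime. -/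

import Mathlib

open MeasureTheory
open scoped ComplexConjugate

namespace OpHardy

/-- The Borel `σ`-algebra on the unit circle `𝕋`. -/
noncomputable instance : MeasurableSpace Circle := borel Circle

instance : BorelSpace Circle := ⟨rfl⟩

instance : Fact (0 < 2 * Real.pi) := ⟨Real.two_pi_pos⟩

/-- The normalized Lebesgue measure `m` on the unit circle `𝕋`: the image of the normalized
Lebesgue measure on `ℝ / 2πℤ` under `t ↦ e^{it}`. -/
noncomputable def m : Measure Circle :=
  (AddCircle.haarAddCircle : Measure (AddCircle (2 * Real.pi))).map AddCircle.toCircle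

instance : IsProbabilityMeasure m :=
  Measure.isProbabilityMeasure_map AddCircle.continuous_toCircle.measurable.aemeasurable

/-- Integration against `m` is `(1 / 2π) ∫_{-π}^{π} f(e^{it}) dt`. -/
theorem integral_m {X : Type*} [NormedAddCommGroup X] [NormedSpace ℝ X] (f : Circle → X) :
    ∫ z, f z ∂m =
      (2 * Real.pi)⁻¹ • ∫ t in (-Real.pi)..Real.pi, f (Circle.exp t) := by
  have he : MeasurableEmbedding (AddCircle.toCircle : AddCircle (2 * Real.pi) → Circle) := by
    have h := (AddCircle.homeomorphCircle Real.two_pi_pos.ne').measurableEmbedding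
    have h0 : (AddCircle.toCircle : AddCircle (2 * Real.pi) → Circle) =
        AddCircle.homeomorphCircle Real.two_pi_pos.ne' := by
      funext x
      exact (AddCircle.homeomorphCircle_apply _ x).symm
    rw [h0]
    exact h
  rw [m, he.integral_map, AddCircle.integral_haarAddCircle]
  congr 1
  have h := AddCircle.intervalIntegral_preimage (2 * Real.pi) (-Real.pi)
    (fun b => f (AddCircle.toCircle b))
  rw [← h]
  have h2 : -Real.pi + 2 * Real.pi = Real.pi := by ring
  rw [h2]
  simp only [AddCircle.toCircle_apply_mk]
  have h3 : 2 * Real.pi / (2 * Real.pi) = 1 := div_self Real.two_pi_pos.ne'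
  simp only [h3, one_mul]

section Spaces

variable {D E : Type*}
  [NormedAddCommGroup D] [InnerProductSpace ℂ D] [CompleteSpace D]
  [NormedAddCommGroup E] [InnerProductSpace ℂ E] [CompleteSpace E]

/-- The `n`-th Fourier coefficient of a vector-valued function on `𝕋`,
`f̂(n) = ∫ z̄ⁿ f(z) dm(z)` (Bochner integral). -/
noncomputable def fourierCoef (f : Circle → E) (n : ℤ) : E :=
  ∫ z, (conj (z : ℂ)) ^ n • f z ∂m

/-- `Φ ∈ H^∞(𝕋, B(D, E))`: `Φ` is SOT-measurable, (essentially) bounded, and its Fourier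
coefficients, given by `Φ̂(n) x = (Φ(·)x)^(n)`, vanish for `n < 0`. Functions on `𝕋` are identified
when they are equal `m`-almost everywhere, so all relations below are required a.e. only. -/
structure IsHInfty (Φ : Circle → D →L[ℂ] E) : Prop where
  measurable : ∀ x : D, AEStronglyMeasurable (fun z => Φ z x) m
  bounded : ∃ C : ℝ, ∀ᵐ z ∂m, ‖Φ z‖ ≤ C
  analytic : ∀ x : D, ∀ n : ℤ, n < 0 → fourierCoef (fun z => Φ z x) n = 0

/-- The Poisson integral `P[Φ](ζ) x = ∫ (1 - |ζ|²) / |z - ζ|² Φ(z) x dm(z)`, for `|ζ| < 1`. With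
`ζ = r e^{iθ}`, `z = e^{it}` the kernel is `P_r(θ - t)`. -/
noncomputable def poissonIntegral (Φ : Circle → D →L[ℂ] E) (ζ : ℂ) : D → E :=
  fun x => ∫ z, poissonKernel 0 ζ (z : ℂ) • Φ z x ∂m

/-- `Δ` is inner: `Δ ∈ H^∞(𝕋, B(D, E))` and `Δ* Δ = I_D` a.e. on `𝕋`. -/
def IsInner (Δ : Circle → D →L[ℂ] E) : Prop :=
  IsHInfty Δ ∧ ∀ᵐ z ∂m, (ContinuousLinearMap.adjoint (Δ z)) ∘L Δ z = ContinuousLinearMap.id ℂ D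

/-- `Φ̃(z) = Φ(z̄)*`; on the unit circle `z̄ = z⁻¹`. -/
noncomputable def tilde (Φ : Circle → D →L[ℂ] E) : Circle → E →L[ℂ] D :=
  fun z => ContinuousLinearMap.adjoint (Φ z⁻¹)

/-- `Δ` agrees a.e. with a constant unitary operator on `E`. -/
def IsUnitaryConstant (Δ : Circle → E →L[ℂ] E) : Prop :=
  ∃ V ∈ unitary (E →L[ℂ] E), ∀ᵐ z ∂m, Δ z = V

end Spaces

section Divisors

variable {D D₁ D₂ D' E : Type*}
  [NormedAddCommGroup D] [InnerProductSpace ℂ D] [CompleteSpace D]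
  [NormedAddCommGroup D₁] [InnerProductSpace ℂ D₁] [CompleteSpace D₁]
  [NormedAddCommGroup D₂] [InnerProductSpace ℂ D₂] [CompleteSpace D₂]
  [NormedAddCommGroup D'] [InnerProductSpace ℂ D'] [CompleteSpace D']
  [NormedAddCommGroup E] [InnerProductSpace ℂ E] [CompleteSpace E]

/-- The inner function `Δ` is a left inner divisor of `Φ`: `Φ = Δ A` a.e. on `𝕋` for some
`A ∈ H^∞(𝕋, B(D, D'))`. -/
def IsLeftInnerDivisor (Δ : Circle → D' →L[ℂ] E) (Φ : Circle → D →L[ℂ] E) : Prop :=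
  IsInner Δ ∧ ∃ A : Circle → D →L[ℂ] D', IsHInfty A ∧ ∀ᵐ z ∂m, Φ z = Δ z ∘L A z

/-- A nontrivial left inner divisor: a `B(E)`-valued left inner divisor that is not a (constant)
unitary operator. -/
def IsNontrivialLeftInnerDivisor (Δ : Circle → E →L[ℂ] E) (Φ : Circle → D →L[ℂ] E) : Prop :=
  IsLeftInnerDivisor Δ Φ ∧ ¬ IsUnitaryConstant Δ

/-- `Φ` and `Ψ` are left coprime: they have no common nontrivial left inner divisor. -/
def LeftCoprime (Φ : Circle → D₁ →L[ℂ] E) (Ψ : Circle → D₂ →L[ℂ] E) : Prop :=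
  ¬ ∃ Δ : Circle → E →L[ℂ] E,
    IsNontrivialLeftInnerDivisor Δ Φ ∧ IsNontrivialLeftInnerDivisor Δ Ψ

/-- `Φ` and `Ψ` are right coprime: `Φ̃` and `Ψ̃` are left coprime. -/
def RightCoprime (Φ : Circle → E →L[ℂ] D₁) (Ψ : Circle → E →L[ℂ] D₂) : Prop :=
  LeftCoprime (tilde Φ) (tilde Ψ)

end Divisors

/-- The Blaschke factor `b_a(z) = (z - a) / (1 - ā z)`. -/
noncomputable def blaschkeFactor (a z : ℂ) : ℂ := (z - a) / (1 - conj a * z)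

/-- `θ` is, on the closed unit disc, a finite Blaschke product `ν ∏ b_{a_i}` with `|ν| = 1` and
`|a_i| < 1`, repetitions allowed. -/
def IsFiniteBlaschkeProduct (θ : ℂ → ℂ) : Prop :=
  ∃ (ν : ℂ) (n : ℕ) (a : Fin n → ℂ), ‖ν‖ = 1 ∧ (∀ i, ‖a i‖ < 1) ∧
    ∀ z : ℂ, ‖z‖ ≤ 1 → θ z = ν * ∏ i, blaschkeFactor (a i) z

/-- `𝒵(θ)`, the set of zeros of `θ` in the open unit disc. -/
def zeroSet (θ : ℂ → ℂ) : Set ℂ := {α | ‖α‖ < 1 ∧ θ α = 0}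

/-- The operator-valued function `Θ = θ I_E` on `𝕋`. -/
noncomputable def scalarFun (E : Type*) [NormedAddCommGroup E] [InnerProductSpace ℂ E]
    (θ : ℂ → ℂ) : Circle → E →L[ℂ] E :=
  fun z => θ (z : ℂ) • ContinuousLinearMap.id ℂ E

end OpHardy

namespace OpHardy

/-! Everything rests on three facts about bounded analytic boundary functions: the Poisson integral
is multiplicative (`IsHInfty.poissonVec_apply`), P[Φ̃](ā) = P[Φ](a)*
(`IsHInfty.inner_poissonIntegral_tilde`), and f can be divided by b_a exactly when P[f](a) = 0
(`IsHInftyVec.conj_blaschkeFactor_smul` and `IsHInftyVec.poissonVec_blaschkeFactor_smul`).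

(a) ⇒ (b): let Δ divide both Φ̃ = ΔA₁ and Θ̃ = ψI = ΔA. As ψ is unimodular, Δ is unitary a.e. and AΔ
= ψI. At a zero ā of ψ, P[Φ̃](ā) = P[Φ](a)* has dense range, hence so has P[Δ](ā), and
P[A](ā)P[Δ](ā) = 0 forces P[A](ā) = 0. So b_ā divides A. Removing all factors leaves an analytic
multiple of Δ*; since Δ and Δ* are both analytic, Δ is constant.

(b) ⇒ (a): if P[Φ](a)u = 0 with ‖u‖ = 1, the inner function acting as b_ā on u and as the identity
on its complement divides both Φ̃ and Θ̃. -/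

/-! ### Transfer to the additive circle, and Parseval. -/

theorem measurableEmbedding_toCircle :
    MeasurableEmbedding (AddCircle.toCircle : AddCircle (2 * Real.pi) → Circle) := by
  have h := (AddCircle.homeomorphCircle Real.two_pi_pos.ne').measurableEmbedding
  have h0 : (AddCircle.toCircle : AddCircle (2 * Real.pi) → Circle) =
      AddCircle.homeomorphCircle Real.two_pi_pos.ne' := by
    funext x
    exact (AddCircle.homeomorphCircle_apply _ x).symm
  rw [h0]
  exact h

theorem measurePreserving_toCircle :
    MeasurePreserving (AddCircle.toCircle : AddCircle (2 * Real.pi) → Circle)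
      AddCircle.haarAddCircle m :=
  ⟨AddCircle.continuous_toCircle.measurable, rfl⟩

theorem integral_toCircle {X : Type*} [NormedAddCommGroup X] [NormedSpace ℝ X] (f : Circle → X) :
    ∫ z, f z ∂m = ∫ t, f (AddCircle.toCircle t)
      ∂(AddCircle.haarAddCircle : Measure (AddCircle (2 * Real.pi))) := by
  rw [m, measurableEmbedding_toCircle.integral_map]

theorem measurePreserving_inv : MeasurePreserving (fun z : Circle => z⁻¹) m m := by
  have hneg : MeasurePreserving (fun t : AddCircle (2 * Real.pi) => -t)
      AddCircle.haarAddCircle AddCircle.haarAddCircle :=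
    Measure.measurePreserving_neg _
  refine ⟨continuous_inv.measurable, ?_⟩
  have h := (measurePreserving_toCircle.comp hneg).map_eq
  conv_lhs => rw [m, Measure.map_map continuous_inv.measurable
    AddCircle.continuous_toCircle.measurable]
  rw [← h]
  congr 1
  funext t
  simp [AddCircle.toCircle_neg]

theorem integral_comp_inv {X : Type*} [NormedAddCommGroup X] [NormedSpace ℝ X] (f : Circle → X) :
    ∫ z, f z⁻¹ ∂m = ∫ z, f z ∂m :=
  measurePreserving_inv.integral_comp (Homeomorph.inv Circle).measurableEmbedding f

theorem fourier_toCircle (n : ℤ) (t : AddCircle (2 * Real.pi)) :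
    fourier n t = (AddCircle.toCircle t : ℂ) ^ n := by
  rw [fourier_apply, AddCircle.toCircle_zsmul, Circle.coe_zpow]

/-- Parseval: the integral of `u * v` vanishes once all products of opposite Fourier coefficients
do. -/
theorem integral_mul_eq_zero {u v : Circle → ℂ} (hu : MemLp u 2 m) (hv : MemLp v 2 m)
    (h : ∀ k : ℤ, (∫ z, (z : ℂ) ^ k * u z ∂m) * (∫ z, (z : ℂ) ^ (-k) * v z ∂m) = 0) :
    ∫ z, u z * v z ∂m = 0 := by
  -- The conjugate on `u` turns the L² inner product into the bilinear integral of `u * v`.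
  have hU : MemLp (fun t : AddCircle (2 * Real.pi) => conj (u (AddCircle.toCircle t))) 2
      AddCircle.haarAddCircle := (hu.comp_measurePreserving measurePreserving_toCircle).star
  have hV : MemLp (fun t : AddCircle (2 * Real.pi) => v (AddCircle.toCircle t)) 2
      AddCircle.haarAddCircle := hv.comp_measurePreserving measurePreserving_toCircle
  have key := fourierBasis.hasSum_inner_mul_inner hU.toLp hV.toLp
  have hinner : inner ℂ hU.toLp hV.toLp = ∫ z, u z * v z ∂m := by
    rw [L2.inner_def, integral_toCircle]
    refine integral_congr_ae ?_
    filter_upwards [hU.coeFn_toLp, hV.coeFn_toLp] with t h1 h2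
    rw [h1, h2]
    simp [mul_comm]
  have hcoef : ∀ k : ℤ, inner ℂ hU.toLp (fourierBasis k) * inner ℂ (fourierBasis k) hV.toLp
      = 0 := by
    intro k
    rw [← h k, ← inner_conj_symm hU.toLp, ← HilbertBasis.repr_apply_apply,
      ← HilbertBasis.repr_apply_apply, fourierBasis_repr, fourierBasis_repr,
      fourierCoeff_congr_ae hU.coeFn_toLp, fourierCoeff_congr_ae hV.coeFn_toLp, fourierCoeff,
      fourierCoeff, ← integral_conj, integral_toCircle, integral_toCircle]
    congr 1
    · refine integral_congr_ae (Filter.Eventually.of_forall fun t => ?_)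
      simp only [smul_eq_mul, map_mul, RCLike.conj_conj, fourier_toCircle, map_zpow₀,
        ← Circle.coe_inv_eq_conj, Circle.coe_inv, inv_zpow', neg_neg]
    · simp only [smul_eq_mul, fourier_toCircle]
  rw [hinner] at key
  simp only [hcoef] at key
  exact key.unique hasSum_zero

/-! ### Essentially bounded functions. -/

section EssBdd

variable {D E : Type*} [NormedAddCommGroup E] [NormedAddCommGroup D]

/-- Essentially bounded strongly measurable functions on the circle. -/
structure EssBdd (f : Circle → E) : Prop where
  measurable : AEStronglyMeasurable f m
  bounded : ∃ C : ℝ, ∀ᵐ z ∂m, ‖f z‖ ≤ C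

theorem EssBdd.memLp {f : Circle → E} (hf : EssBdd f) (p : ENNReal) : MemLp f p m := by
  obtain ⟨C, hC⟩ := hf.bounded
  exact MemLp.of_bound hf.measurable C hC

theorem EssBdd.integrable {f : Circle → E} (hf : EssBdd f) : Integrable f m :=
  memLp_one_iff_integrable.1 (hf.memLp 1)

theorem essBdd_of_continuous {f : Circle → E} (hf : Continuous f) : EssBdd f := by
  refine ⟨hf.aestronglyMeasurable, ?_⟩
  obtain ⟨C, hC⟩ := (isCompact_range hf).isBounded.exists_norm_le
  exact ⟨C, Filter.Eventually.of_forall fun z => hC _ ⟨z, rfl⟩⟩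

theorem essBdd_const (x : E) : EssBdd (fun _ => x) :=
  essBdd_of_continuous continuous_const

theorem EssBdd.add {f g : Circle → E} (hf : EssBdd f) (hg : EssBdd g) :
    EssBdd (fun z => f z + g z) := by
  refine ⟨hf.measurable.add hg.measurable, ?_⟩
  obtain ⟨C, hC⟩ := hf.bounded
  obtain ⟨C', hC'⟩ := hg.bounded
  refine ⟨C + C', ?_⟩
  filter_upwards [hC, hC'] with z h h'
  exact (norm_add_le _ _).trans (add_le_add h h')

variable [NormedSpace ℂ E] [NormedSpace ℂ D]

theorem EssBdd.smul {u : Circle → ℂ} {f : Circle → E} (hu : EssBdd u) (hf : EssBdd f) :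
    EssBdd (fun z => u z • f z) := by
  refine ⟨hu.measurable.smul hf.measurable, ?_⟩
  obtain ⟨C, hC⟩ := hu.bounded
  obtain ⟨C', hC'⟩ := hf.bounded
  refine ⟨C * C', ?_⟩
  filter_upwards [hC, hC'] with z h h'
  rw [norm_smul]
  exact mul_le_mul h h' (norm_nonneg _) ((norm_nonneg _).trans h)

theorem EssBdd.clm {f : Circle → E} (hf : EssBdd f) (L : E →L[ℂ] D) :
    EssBdd (fun z => L (f z)) := by
  refine ⟨L.continuous.comp_aestronglyMeasurable hf.measurable, ?_⟩
  obtain ⟨C, hC⟩ := hf.bounded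
  refine ⟨‖L‖ * C, ?_⟩
  filter_upwards [hC] with z h
  exact (L.le_opNorm _).trans (mul_le_mul_of_nonneg_left h (norm_nonneg _))

theorem continuous_circle_coe : Continuous (fun z : Circle => (z : ℂ)) :=
  continuous_subtype_val

theorem essBdd_pow (k : ℕ) : EssBdd (fun z : Circle => (z : ℂ) ^ k) :=
  essBdd_of_continuous (continuous_circle_coe.pow k)

end EssBdd

/-! ### Vector-valued bounded analytic functions and their Poisson integrals. -/

section Vec

variable {D E : Type*} [NormedAddCommGroup E] [NormedSpace ℂ E]
  [NormedAddCommGroup D] [NormedSpace ℂ D]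

/-- Bounded analytic vector-valued boundary functions. -/
structure IsHInftyVec (f : Circle → E) : Prop extends EssBdd f where
  analytic : ∀ k : ℕ, ∫ z, (z : ℂ) ^ (k + 1) • f z ∂m = 0

/-- The Poisson integral of a vector-valued function. -/
noncomputable def poissonVec (f : Circle → E) (a : ℂ) : E :=
  ∫ z, poissonKernel 0 a (z : ℂ) • f z ∂m

theorem conj_mul_self_circle (z : Circle) : conj (z : ℂ) * z = 1 := by
  rw [← Circle.coe_inv_eq_conj, ← Circle.coe_mul, inv_mul_cancel, Circle.coe_one]

theorem norm_conj_circle (z : Circle) : ‖conj (z : ℂ)‖ = 1 := by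
  rw [RCLike.norm_conj, Circle.norm_coe]

theorem one_sub_mul_ne_zero {a w : ℂ} (ha : ‖a‖ < 1) (hw : ‖w‖ ≤ 1) : 1 - a * w ≠ 0 := by
  intro h
  have h1 : ‖a * w‖ = 1 := by rw [← sub_eq_zero.1 h, norm_one]
  rw [norm_mul] at h1
  nlinarith [norm_nonneg a, norm_nonneg w]

theorem essBdd_inv_one_sub {a : ℂ} (ha : ‖a‖ < 1) :
    EssBdd (fun z : Circle => (1 - a * (z : ℂ))⁻¹) :=
  essBdd_of_continuous <| Continuous.inv₀ (by fun_prop)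
    fun z => one_sub_mul_ne_zero ha (Circle.norm_coe z).le

theorem essBdd_inv_one_sub_conj {a : ℂ} (ha : ‖a‖ < 1) :
    EssBdd (fun z : Circle => (1 - a * conj (z : ℂ))⁻¹) :=
  essBdd_of_continuous <| Continuous.inv₀
    (continuous_const.sub (continuous_const.mul (Complex.continuous_conj.comp
      continuous_circle_coe)))
    fun z => one_sub_mul_ne_zero ha (norm_conj_circle z).le

/-- Cauchy-type kernels annihilate analytic functions. -/
theorem IsHInftyVec.integral_inv_one_sub {f : Circle → E} (hf : IsHInftyVec f) {a : ℂ}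
    (ha : ‖a‖ < 1) (k : ℕ) :
    ∫ z, ((z : ℂ) ^ (k + 1) * (1 - a * (z : ℂ))⁻¹) • f z ∂m = 0 := by
  have hint : ∀ j : ℕ, Integrable (fun z : Circle =>
      ((z : ℂ) ^ (j + 1) * (1 - a * (z : ℂ))⁻¹) • f z) m := fun j =>
    (((essBdd_pow (j + 1)).smul (essBdd_inv_one_sub ha)).smul hf.toEssBdd).integrable
  obtain ⟨C, hC⟩ := ((essBdd_inv_one_sub ha).smul hf.toEssBdd).bounded
  have hbd : ∀ j : ℕ, ‖∫ z, ((z : ℂ) ^ (j + 1) * (1 - a * (z : ℂ))⁻¹) • f z ∂m‖ ≤ C := by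
    intro j
    refine (norm_integral_le_of_norm_le_const (C := C) ?_).trans (by simp)
    filter_upwards [hC] with z hz
    rw [mul_smul, norm_smul, norm_pow, Circle.norm_coe, one_pow, one_mul]
    exact hz
  -- Multiplying the kernel by 1 - az leaves a pure power, which `f` annihilates. Iterating this
  -- recursion bounds the integral by ‖a‖ʲ C, so no series expansion is needed.
  have hstep : ∀ j : ℕ, ∫ z, ((z : ℂ) ^ (j + 1) * (1 - a * (z : ℂ))⁻¹) • f z ∂m =
      a • ∫ z, ((z : ℂ) ^ (j + 1 + 1) * (1 - a * (z : ℂ))⁻¹) • f z ∂m := by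
    intro j
    rw [← integral_smul, ← sub_eq_zero, ← integral_sub (hint j) ((hint (j + 1)).fun_smul a),
      ← hf.analytic j]
    refine integral_congr_ae (Filter.Eventually.of_forall fun z => ?_)
    have := one_sub_mul_ne_zero ha (Circle.norm_coe z).le
    simp only [← mul_smul, ← sub_smul]
    congr 1
    field_simp
    ring
  have hiter : ∀ j : ℕ, ∫ z, ((z : ℂ) ^ (k + 1) * (1 - a * (z : ℂ))⁻¹) • f z ∂m =
      a ^ j • ∫ z, ((z : ℂ) ^ (k + j + 1) * (1 - a * (z : ℂ))⁻¹) • f z ∂m := by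
    intro j
    induction j with
    | zero => simp
    | succ j ih => rw [ih, hstep (k + j), ← mul_smul, ← pow_succ]; rfl
  have hlim : Filter.Tendsto (fun j : ℕ => ‖a‖ ^ j * C) Filter.atTop (nhds 0) := by
    simpa using (tendsto_pow_atTop_nhds_zero_of_lt_one (norm_nonneg a) ha).mul_const C
  refine norm_le_zero_iff.1 (ge_of_tendsto' hlim fun j => ?_)
  rw [hiter j, norm_smul, norm_pow]
  exact mul_le_mul_of_nonneg_left (hbd _) (by positivity)

/-- Splits the kernel into the Cauchy kernel and a part with only positive powers of z; the latter
annihilates analytic functions. The exponent `0 + 1` matches `IsHInftyVec.integral_inv_one_sub` at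
`k = 0`. -/
theorem poissonKernel_circle {a : ℂ} (ha : ‖a‖ < 1) (z : Circle) :
    ((poissonKernel 0 a (z : ℂ) : ℝ) : ℂ) =
      (1 - a * conj (z : ℂ))⁻¹ + conj a * ((z : ℂ) ^ (0 + 1) * (1 - conj a * (z : ℂ))⁻¹) := by
  have h1 := one_sub_mul_ne_zero ha (norm_conj_circle z).le
  have h2 := one_sub_mul_ne_zero (a := conj a) (by simpa using ha) (Circle.norm_coe z).le
  have hz := conj_mul_self_circle z
  have hden : ((‖(z : ℂ) - a‖ ^ 2 : ℝ) : ℂ) = (1 - a * conj (z : ℂ)) * (1 - conj a * z) := by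
    rw [← Complex.normSq_eq_norm_sq, Complex.normSq_eq_conj_mul_self, map_sub]
    linear_combination (1 - conj a * a) * hz
  have hnum : ((‖a‖ ^ 2 : ℝ) : ℂ) = conj a * a := by
    rw [← Complex.normSq_eq_norm_sq, Complex.normSq_eq_conj_mul_self]
  rw [poissonKernel_def]
  simp only [sub_zero, Circle.norm_coe, Complex.ofReal_div, hden]
  rw [div_eq_iff (mul_ne_zero h1 h2), Complex.ofReal_sub, hnum]
  push_cast
  field_simp
  linear_combination (conj a * a) * hz

theorem essBdd_poissonKernel {a : ℂ} (ha : ‖a‖ < 1) :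
    EssBdd (fun z : Circle => ((poissonKernel 0 a (z : ℂ) : ℝ) : ℂ)) := by
  simp only [poissonKernel_circle ha]
  exact (essBdd_inv_one_sub_conj ha).add ((essBdd_const (conj a)).smul
    ((essBdd_pow (0 + 1)).smul (essBdd_inv_one_sub (by simpa using ha))))

theorem poissonVec_eq (f : Circle → E) (a : ℂ) :
    poissonVec f a = ∫ z, ((poissonKernel 0 a (z : ℂ) : ℝ) : ℂ) • f z ∂m := rfl

theorem IsHInftyVec.poissonVec_eq_cauchy {f : Circle → E} (hf : IsHInftyVec f) {a : ℂ}
    (ha : ‖a‖ < 1) : poissonVec f a = ∫ z, (1 - a * conj (z : ℂ))⁻¹ • f z ∂m := by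
  have ha' : ‖conj a‖ < 1 := by simpa using ha
  rw [poissonVec_eq]
  simp only [poissonKernel_circle ha, add_smul, mul_smul (conj a)]
  have hint : Integrable (fun z : Circle =>
      ((z : ℂ) ^ (0 + 1) * (1 - conj a * (z : ℂ))⁻¹) • f z) m :=
    (((essBdd_pow (0 + 1)).smul (essBdd_inv_one_sub ha')).smul hf.toEssBdd).integrable
  rw [integral_add ((essBdd_inv_one_sub_conj ha).smul hf.toEssBdd).integrable (hint.fun_smul _),
    integral_smul, hf.integral_inv_one_sub ha' 0, smul_zero, add_zero]

theorem poissonVec_congr {f g : Circle → E} (h : f =ᵐ[m] g) (a : ℂ) :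
    poissonVec f a = poissonVec g a := by
  refine integral_congr_ae ?_
  filter_upwards [h] with z hz
  rw [hz]

theorem EssBdd.poissonVec_integrable {f : Circle → E} (hf : EssBdd f) {a : ℂ} (ha : ‖a‖ < 1) :
    Integrable (fun z : Circle => poissonKernel 0 a (z : ℂ) • f z) m :=
  ((essBdd_poissonKernel ha).smul hf).integrable

theorem poissonVec_add {f g : Circle → E} (hf : EssBdd f) (hg : EssBdd g) {a : ℂ} (ha : ‖a‖ < 1) :
    poissonVec (fun z => f z + g z) a = poissonVec f a + poissonVec g a := by
  simp only [poissonVec, smul_add]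
  exact integral_add (hf.poissonVec_integrable ha) (hg.poissonVec_integrable ha)

theorem poissonVec_clm [CompleteSpace E] [CompleteSpace D] {f : Circle → E} (hf : EssBdd f) (L : E →L[ℂ] D) {a : ℂ} (ha : ‖a‖ < 1) :
    poissonVec (fun z => L (f z)) a = L (poissonVec f a) := by
  rw [poissonVec_eq, poissonVec, ← L.integral_comp_comm (hf.poissonVec_integrable ha)]
  refine integral_congr_ae (Filter.Eventually.of_forall fun z => ?_)
  exact (L.map_smul _ _).symm

theorem IsHInftyVec.congr {f g : Circle → E} (hf : IsHInftyVec f) (h : f =ᵐ[m] g) :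
    IsHInftyVec g := by
  obtain ⟨C, hC⟩ := hf.bounded
  refine ⟨⟨hf.measurable.congr h, C, ?_⟩, fun k => ?_⟩
  · filter_upwards [hC, h] with z h1 h2
    rwa [← h2]
  · rw [← hf.analytic k]
    refine integral_congr_ae ?_
    filter_upwards [h] with z h2
    rw [h2]

theorem IsHInftyVec.add {f g : Circle → E} (hf : IsHInftyVec f) (hg : IsHInftyVec g) :
    IsHInftyVec (fun z => f z + g z) := by
  refine ⟨hf.toEssBdd.add hg.toEssBdd, fun k => ?_⟩
  simp only [smul_add]
  rw [integral_add ((essBdd_pow _).smul hf.toEssBdd).integrable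
    ((essBdd_pow _).smul hg.toEssBdd).integrable, hf.analytic, hg.analytic, add_zero]

theorem IsHInftyVec.clm [CompleteSpace E] [CompleteSpace D] {f : Circle → E} (hf : IsHInftyVec f) (L : E →L[ℂ] D) :
    IsHInftyVec (fun z => L (f z)) := by
  refine ⟨hf.toEssBdd.clm L, fun k => ?_⟩
  simp only [← map_smul]
  rw [L.integral_comp_comm ((essBdd_pow _).smul hf.toEssBdd).integrable, hf.analytic, map_zero]

theorem IsHInftyVec.sub [CompleteSpace E] {f g : Circle → E} (hf : IsHInftyVec f) (hg : IsHInftyVec g) :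
    IsHInftyVec (fun z => f z - g z) := by
  simpa [sub_eq_add_neg] using hf.add (hg.clm (-ContinuousLinearMap.id ℂ E))

theorem integral_pow_succ (k : ℕ) : ∫ z, ((z : Circle) : ℂ) ^ (k + 1) ∂m = 0 := by
  have h := fourierCoeff_fourier (T := 2 * Real.pi) (k + 1 : ℤ)
  have h0 := congrFun h 0
  rw [fourierCoeff, Pi.single_eq_of_ne (by omega)] at h0
  rw [integral_toCircle, ← h0]
  refine integral_congr_ae (Filter.Eventually.of_forall fun t => ?_)
  simp only [fourier_toCircle, neg_zero, zpow_zero, one_smul]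
  norm_cast

theorem isHInftyVec_const [CompleteSpace E] (x : E) : IsHInftyVec (fun _ : Circle => x) := by
  refine ⟨essBdd_const x, fun k => ?_⟩
  rw [integral_smul_const, integral_pow_succ, zero_smul]

theorem poissonVec_const [CompleteSpace E] (x : E) {a : ℂ} (ha : ‖a‖ < 1) :
    poissonVec (fun _ : Circle => x) a = x := by
  have ha' : ‖conj a‖ < 1 := by simpa using ha
  have h1 : ∫ z : Circle, (1 - conj a * (z : ℂ))⁻¹ ∂m = 1 := by
    have h2 := (isHInftyVec_const (1 : ℂ)).integral_inv_one_sub ha' 0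
    -- The kernel is 1 plus positive powers of z, which integrate to zero. The Cauchy kernel itself
    -- is the conjugate of this one.
    have h3 : ∀ z : Circle, (1 - conj a * (z : ℂ))⁻¹ =
        1 + conj a • (((z : ℂ) ^ (0 + 1) * (1 - conj a * (z : ℂ))⁻¹) • (1 : ℂ)) := by
      intro z
      have := one_sub_mul_ne_zero ha' (Circle.norm_coe z).le
      simp only [smul_eq_mul]
      field_simp
      ring
    have hint : Integrable (fun z : Circle =>
        ((z : ℂ) ^ (0 + 1) * (1 - conj a * (z : ℂ))⁻¹) • (1 : ℂ)) m :=
      (((essBdd_pow (0 + 1)).smul (essBdd_inv_one_sub ha')).smul (essBdd_const 1)).integrable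
    rw [integral_congr_ae (Filter.Eventually.of_forall h3),
      integral_add (integrable_const _) (hint.fun_smul _), integral_smul, h2]
    simp
  rw [(isHInftyVec_const x).poissonVec_eq_cauchy ha, integral_smul_const]
  have h4 : ∫ z : Circle, (1 - a * conj (z : ℂ))⁻¹ ∂m = 1 := by
    have := congrArg conj h1
    rw [← integral_conj, map_one] at this
    simpa [map_inv₀] using this
  rw [h4, one_smul]

end Vec

/-! ### Multiplication and division by a Blaschke factor. -/

section Blaschke

variable {E : Type*} [NormedAddCommGroup E] [NormedSpace ℂ E]

theorem norm_blaschkeFactor {a : ℂ} (ha : ‖a‖ < 1) (z : Circle) : ‖blaschkeFactor a z‖ = 1 := by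
  have h2 := one_sub_mul_ne_zero (a := conj a) (by simpa using ha) (Circle.norm_coe z).le
  have h : (1 - conj a * (z : ℂ)) = z * conj ((z : ℂ) - a) := by
    rw [map_sub]
    linear_combination - conj_mul_self_circle z
  rw [blaschkeFactor, norm_div, div_eq_one_iff_eq (norm_ne_zero_iff.2 h2), h, norm_mul,
    Circle.norm_coe, one_mul, RCLike.norm_conj]

theorem conj_mul_blaschkeFactor {a : ℂ} (ha : ‖a‖ < 1) (z : Circle) :
    conj (blaschkeFactor a z) * blaschkeFactor a z = 1 := by
  rw [← Complex.normSq_eq_conj_mul_self, Complex.normSq_eq_norm_sq, norm_blaschkeFactor ha]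
  simp

theorem essBdd_blaschkeFactor {a : ℂ} (ha : ‖a‖ < 1) :
    EssBdd (fun z : Circle => blaschkeFactor a z) := by
  refine essBdd_of_continuous (Continuous.div (by fun_prop) (by fun_prop) fun z => ?_)
  exact one_sub_mul_ne_zero (by simpa using ha) (Circle.norm_coe z).le

theorem EssBdd.conj {u : Circle → ℂ} (hu : EssBdd u) : EssBdd (fun z => conj (u z)) := by
  refine ⟨Complex.continuous_conj.comp_aestronglyMeasurable hu.measurable, ?_⟩
  simpa using hu.bounded

theorem IsHInftyVec.blaschkeFactor_smul {f : Circle → E} (hf : IsHInftyVec f) {a : ℂ}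
    (ha : ‖a‖ < 1) : IsHInftyVec (fun z => blaschkeFactor a z • f z) := by
  have ha' : ‖conj a‖ < 1 := by simpa using ha
  refine ⟨(essBdd_blaschkeFactor ha).smul hf.toEssBdd, fun k => ?_⟩
  have h : ∀ z : Circle, (z : ℂ) ^ (k + 1) • blaschkeFactor a z • f z =
      ((z : ℂ) ^ (k + 1 + 1) * (1 - conj a * (z : ℂ))⁻¹) • f z -
        a • ((z : ℂ) ^ (k + 1) * (1 - conj a * (z : ℂ))⁻¹) • f z := by
    intro z
    simp only [← mul_smul, ← sub_smul, blaschkeFactor]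
    congr 1
    ring
  simp only [h]
  have hint : ∀ j : ℕ, Integrable (fun z : Circle =>
      ((z : ℂ) ^ (j + 1) * (1 - conj a * (z : ℂ))⁻¹) • f z) m := fun j =>
    (((essBdd_pow (j + 1)).smul (essBdd_inv_one_sub ha')).smul hf.toEssBdd).integrable
  rw [integral_sub (hint (k + 1)) ((hint k).fun_smul a), integral_smul,
    hf.integral_inv_one_sub ha', hf.integral_inv_one_sub ha', smul_zero, sub_zero]

/-- On the circle z - a = z(1 - a z̄), so b_a cancels the Cauchy kernel at a and leaves z / (1 - ā
z), which annihilates `f`. -/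
theorem IsHInftyVec.poissonVec_blaschkeFactor_smul {f : Circle → E} (hf : IsHInftyVec f) {a : ℂ}
    (ha : ‖a‖ < 1) : poissonVec (fun z => blaschkeFactor a z • f z) a = 0 := by
  have ha' : ‖conj a‖ < 1 := by simpa using ha
  rw [(hf.blaschkeFactor_smul ha).poissonVec_eq_cauchy ha, ← hf.integral_inv_one_sub ha' 0]
  refine integral_congr_ae (Filter.Eventually.of_forall fun z => ?_)
  have h1 := one_sub_mul_ne_zero ha (norm_conj_circle z).le
  have h2 := one_sub_mul_ne_zero ha' (Circle.norm_coe z).le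
  simp only [← mul_smul, blaschkeFactor, div_eq_mul_inv]
  congr 1
  linear_combination ((z : ℂ) * (1 - conj a * (z : ℂ))⁻¹) * inv_mul_cancel₀ h1 +
    ((1 - a * conj (z : ℂ))⁻¹ * (1 - conj a * (z : ℂ))⁻¹ * a) * conj_mul_self_circle z

/-- On the circle the conjugate of b_a is its inverse, so this is division by b_a. The moments M_j
of `f` against zʲ / (1 - a z̄) satisfy M_{j+1} = a M_j, and M_0 = P[f](a) = 0; the coefficients of
the quotient are combinations of the M_j. -/
theorem IsHInftyVec.conj_blaschkeFactor_smul {f : Circle → E} (hf : IsHInftyVec f) {a : ℂ}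
    (ha : ‖a‖ < 1) (h0 : poissonVec f a = 0) :
    IsHInftyVec (fun z => conj (blaschkeFactor a z) • f z) := by
  have hint : ∀ j : ℕ, Integrable (fun z : Circle =>
      ((z : ℂ) ^ j * (1 - a * conj (z : ℂ))⁻¹) • f z) m := fun j =>
    (((essBdd_pow j).smul (essBdd_inv_one_sub_conj ha)).smul hf.toEssBdd).integrable
  have hz : ∀ j : ℕ, ∫ z, ((z : ℂ) ^ j * (1 - a * conj (z : ℂ))⁻¹) • f z ∂m = 0 := by
    intro j
    induction j with
    | zero => simpa using (hf.poissonVec_eq_cauchy ha).symm.trans h0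
    | succ j ih =>
      have h : ∫ z, ((z : ℂ) ^ (j + 1) * (1 - a * conj (z : ℂ))⁻¹) • f z ∂m -
          a • ∫ z, ((z : ℂ) ^ j * (1 - a * conj (z : ℂ))⁻¹) • f z ∂m = 0 := by
        rw [← integral_smul, ← integral_sub (hint (j + 1)) ((hint j).fun_smul a), ← hf.analytic j]
        refine integral_congr_ae (Filter.Eventually.of_forall fun z => ?_)
        have h1 := one_sub_mul_ne_zero ha (norm_conj_circle z).le
        simp only [← mul_smul, ← sub_smul]
        congr 1
        field_simp
        linear_combination (a * (z : ℂ) ^ j) * conj_mul_self_circle z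
      rwa [ih, smul_zero, sub_zero] at h
  refine ⟨(essBdd_blaschkeFactor ha).conj.smul hf.toEssBdd, fun k => ?_⟩
  have h : ∀ z : Circle, (z : ℂ) ^ (k + 1) • conj (blaschkeFactor a z) • f z =
      ((z : ℂ) ^ k * (1 - a * conj (z : ℂ))⁻¹) • f z -
        conj a • ((z : ℂ) ^ (k + 1) * (1 - a * conj (z : ℂ))⁻¹) • f z := by
    intro z
    simp only [← mul_smul, ← sub_smul, blaschkeFactor, map_inv₀, map_sub, map_mul, map_one,
      RCLike.conj_conj, div_eq_mul_inv]
    congr 1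
    linear_combination (z : ℂ) ^ k * (1 - a * conj (z : ℂ))⁻¹ * conj_mul_self_circle z
  simp only [h]
  rw [integral_sub (hint k) ((hint (k + 1)).fun_smul _), integral_smul, hz, hz, smul_zero, sub_zero]

end Blaschke

theorem IsHInftyVec.integral_zpow_smul {E : Type*} [NormedAddCommGroup E] [NormedSpace ℂ E]
    {f : Circle → E} (hf : IsHInftyVec f) {n : ℤ} (hn : 0 < n) :
    ∫ z, ((z : Circle) : ℂ) ^ n • f z ∂m = 0 := by
  obtain ⟨k, rfl⟩ : ∃ k : ℕ, n = ((k + 1 : ℕ) : ℤ) := ⟨(n - 1).toNat, by omega⟩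
  simpa only [zpow_natCast] using hf.analytic k

/-! ### Operator-valued functions: products, multiplicativity, adjoints. -/

section Hilbert

set_option linter.unusedSectionVars false

variable {D E F : Type*}
  [NormedAddCommGroup D] [InnerProductSpace ℂ D] [CompleteSpace D]
  [NormedAddCommGroup E] [InnerProductSpace ℂ E] [CompleteSpace E]
  [NormedAddCommGroup F] [InnerProductSpace ℂ F] [CompleteSpace F]

theorem fourierCoef_neg (f : Circle → E) (k : ℕ) :
    fourierCoef f (-(k + 1 : ℕ)) = ∫ z, (z : ℂ) ^ (k + 1) • f z ∂m := by
  refine integral_congr_ae (Filter.Eventually.of_forall fun z => ?_)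
  simp only
  rw [← Circle.coe_inv_eq_conj, Circle.coe_inv, inv_zpow', neg_neg, zpow_natCast]

theorem IsHInfty.vec {Φ : Circle → D →L[ℂ] E} (hΦ : IsHInfty Φ) (x : D) :
    IsHInftyVec (fun z => Φ z x) := by
  refine ⟨⟨hΦ.measurable x, ?_⟩, fun k => ?_⟩
  · obtain ⟨C, hC⟩ := hΦ.bounded
    refine ⟨C * ‖x‖, ?_⟩
    filter_upwards [hC] with z hz
    exact (Φ z).le_of_opNorm_le hz x
  · rw [← fourierCoef_neg]
    exact hΦ.analytic x _ (by omega)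

theorem isHInfty_of_vec {Φ : Circle → D →L[ℂ] E} {C : ℝ} (hC : ∀ᵐ z ∂m, ‖Φ z‖ ≤ C)
    (h : ∀ x, IsHInftyVec (fun z => Φ z x)) : IsHInfty Φ := by
  refine ⟨fun x => (h x).measurable, ⟨C, hC⟩, fun x n hn => ?_⟩
  obtain ⟨k, rfl⟩ : ∃ k : ℕ, n = -((k + 1 : ℕ) : ℤ) := ⟨(-n - 1).toNat, by omega⟩
  rw [fourierCoef_neg]
  exact (h x).analytic k

/-- Pairing with a fixed vector reduces to scalars. In Parseval's sum each term vanishes: the factor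
from `u` when `j ≥ 0`, the one from `f` when `j < 0`. -/
theorem IsHInftyVec.smul {u : Circle → ℂ} {f : Circle → E} (hu : IsHInftyVec u)
    (hf : IsHInftyVec f) : IsHInftyVec (fun z => u z • f z) := by
  refine ⟨hu.toEssBdd.smul hf.toEssBdd, fun k => ext_inner_left ℂ fun y => ?_⟩
  have hg := hf.clm (innerSL ℂ y)
  have hint := ((essBdd_pow (k + 1)).smul (hu.toEssBdd.smul hf.toEssBdd)).integrable
  rw [inner_zero_right, ← integral_inner hint]
  have hku := (essBdd_pow (k + 1)).smul hu.toEssBdd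
  rw [← integral_mul_eq_zero (hku.memLp 2) (hg.toEssBdd.memLp 2)]
  · refine integral_congr_ae (Filter.Eventually.of_forall fun z => ?_)
    simp only [inner_smul_right, innerSL_apply_apply, smul_eq_mul, mul_assoc]
  · intro j
    rcases lt_or_ge j 0 with hj | hj
    · have := hg.integral_zpow_smul (n := -j) (by omega)
      simp only [smul_eq_mul] at this
      rw [this, mul_zero]
    · have := hu.integral_zpow_smul (n := j + (k + 1 : ℕ)) (by omega)
      have h2 : ∀ z : Circle, (z : ℂ) ^ j * ((z : ℂ) ^ (k + 1) • u z) =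
          (z : ℂ) ^ (j + (k + 1 : ℕ)) • u z := by
        intro z
        rw [zpow_add₀ (Circle.coe_ne_zero z), zpow_natCast, smul_eq_mul, smul_eq_mul, mul_assoc]
      simp only [h2]
      rw [this, zero_mul]

/-- Orthonormal vectors are √2 apart, so balls of radius 1/2 around them are disjoint. Countability
makes limits along finite subsets of a basis usable for measurability and dominated convergence. -/
theorem countable_of_orthonormal [TopologicalSpace.SeparableSpace E] {w : Set E}
    (hw : Orthonormal ℂ ((↑) : w → E)) : Countable w := by
  have hdisj : Pairwise (Function.onFun Disjoint fun i : w => Metric.ball (i : E) (1 / 2)) := by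
    intro i j hij
    refine Metric.ball_disjoint_ball ?_
    have h := norm_sub_sq (𝕜 := ℂ) (i : E) j
    rw [hw.1 i, hw.1 j, hw.2 hij] at h
    rw [dist_eq_norm]
    simp only [map_zero] at h
    nlinarith [norm_nonneg ((i : E) - j)]
  exact hdisj.countable_of_isOpen_disjoint (fun i => Metric.isOpen_ball)
    fun i => ⟨(i : E), Metric.mem_ball_self one_half_pos⟩

theorem norm_sum_inner_smul_le {ι : Type*} (b : HilbertBasis ι ℂ E) (s : Finset ι) (x : E) :
    ‖∑ i ∈ s, inner ℂ (b i) x • b i‖ ≤ ‖x‖ := by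
  refine abs_le_of_sq_le_sq' ?_ (norm_nonneg x) |>.2
  refine le_trans (le_of_eq ?_) (b.orthonormal.sum_inner_products_le x (s := s))
  rw [← RCLike.ofReal_inj (K := ℂ), RCLike.ofReal_pow, ← inner_self_eq_norm_sq_to_K,
    b.orthonormal.inner_sum]
  push_cast
  refine Finset.sum_congr rfl fun i _ => ?_
  exact RCLike.conj_mul _

theorem hasSum_apply {ι : Type*} (b : HilbertBasis ι ℂ E) (L : E →L[ℂ] F) (x : E) :
    HasSum (fun i => inner ℂ (b i) x • L (b i)) (L x) := by
  have := (b.hasSum_repr x).mapL L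
  simpa only [map_smul, HilbertBasis.repr_apply_apply] using this

theorem isHInftyVec_sum {ι : Type*} (s : Finset ι) {f : ι → Circle → E}
    (h : ∀ i ∈ s, IsHInftyVec (f i)) : IsHInftyVec (fun z => ∑ i ∈ s, f i z) := by
  classical
  induction s using Finset.induction_on with
  | empty => simpa using isHInftyVec_const (0 : E)
  | insert a s ha ih =>
    simp only [Finset.sum_insert ha]
    exact (h a (Finset.mem_insert_self a s)).add
      (ih fun i hi => h i (Finset.mem_insert_of_mem hi))

/-- An operator-valued bounded analytic function maps bounded analytic functions to bounded
analytic functions. -/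
theorem IsHInfty.apply_vec [TopologicalSpace.SeparableSpace D] {Φ : Circle → D →L[ℂ] E}
    (hΦ : IsHInfty Φ) {f : Circle → D} (hf : IsHInftyVec f) :
    IsHInftyVec (fun z => Φ z (f z)) := by
  obtain ⟨w, b, hb⟩ := exists_hilbertBasis ℂ D
  have hcount : Countable w := countable_of_orthonormal (by rw [← hb]; exact b.orthonormal)
  obtain ⟨C, hC⟩ := hΦ.bounded
  obtain ⟨C', hC'⟩ := hf.bounded
  -- Partial sums of Φf = Σ ⟨bᵢ, f⟩ Φbᵢ are analytic as scalar times vector; Bessel's inequality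
  -- supplies the dominating constant for the limit.
  have hpart : ∀ s : Finset w,
      IsHInftyVec (fun z => ∑ i ∈ s, inner ℂ (b i) (f z) • Φ z (b i)) := fun s =>
    isHInftyVec_sum s fun i _ => (hf.clm (innerSL ℂ (b i))).smul (hΦ.vec (b i))
  have hlim : ∀ z, Filter.Tendsto (fun s : Finset w => ∑ i ∈ s, inner ℂ (b i) (f z) • Φ z (b i))
      Filter.atTop (nhds (Φ z (f z))) := fun z => hasSum_apply b (Φ z) (f z)
  have hmeas : AEStronglyMeasurable (fun z => Φ z (f z)) m :=
    aestronglyMeasurable_of_tendsto_ae Filter.atTop (fun s => (hpart s).measurable)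
      (Filter.Eventually.of_forall hlim)
  have hbound : ∀ᵐ z ∂m, ∀ x : D, ‖x‖ ≤ ‖f z‖ → ‖Φ z x‖ ≤ C * C' := by
    filter_upwards [hC, hC'] with z h h' x hx
    exact ((Φ z).le_opNorm x).trans
      (mul_le_mul h (hx.trans h') (norm_nonneg _) ((norm_nonneg _).trans h))
  refine ⟨⟨hmeas, C * C', ?_⟩, fun k => ?_⟩
  · filter_upwards [hbound] with z h
    exact h _ le_rfl
  · have hconv := tendsto_integral_filter_of_dominated_convergence (μ := m)
      (F := fun (s : Finset w) (z : Circle) =>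
        (z : ℂ) ^ (k + 1) • ∑ i ∈ s, inner ℂ (b i) (f z) • Φ z (b i))
      (f := fun z => (z : ℂ) ^ (k + 1) • Φ z (f z)) (l := Filter.atTop) (fun _ => C * C')
      (Filter.Eventually.of_forall fun s =>
        ((essBdd_pow (k + 1)).smul (hpart s).toEssBdd).measurable)
      (Filter.Eventually.of_forall fun s => by
        filter_upwards [hbound] with z h
        rw [norm_smul, norm_pow, Circle.norm_coe, one_pow, one_mul]
        have h2 := h _ (norm_sum_inner_smul_le b s (f z))
        simpa only [map_sum, map_smul] using h2)
      (integrable_const _)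
      (Filter.Eventually.of_forall fun z => (hlim z).const_smul _)
    simp only [(hpart _).analytic k] at hconv
    exact tendsto_nhds_unique hconv tendsto_const_nhds

/-- The Poisson integral is multiplicative on bounded analytic functions. -/
theorem IsHInfty.poissonVec_apply [TopologicalSpace.SeparableSpace D] {Φ : Circle → D →L[ℂ] E}
    (hΦ : IsHInfty Φ) {f : Circle → D} (hf : IsHInftyVec f) {a : ℂ} (ha : ‖a‖ < 1) :
    poissonVec (fun z => Φ z (f z)) a = poissonIntegral Φ a (poissonVec f a) := by
  set c := poissonVec f a with hc
  have hg0 : IsHInftyVec (fun z => f z + -c) := hf.add (isHInftyVec_const (-c))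
  have hp : poissonVec (fun z => f z + -c) a = 0 := by
    rw [poissonVec_add hf.toEssBdd (essBdd_const _) ha, poissonVec_const _ ha, ← hc, add_neg_cancel]
  have hg := hg0.conj_blaschkeFactor_smul ha hp
  have hΦg := hΦ.apply_vec hg
  -- With c = P[f](a), f = c + b_a g for an analytic g; the term b_a Φg has Poisson integral zero at
  -- a.
  have hdec : ∀ z, Φ z (f z) = Φ z c +
      blaschkeFactor a z • Φ z (conj (blaschkeFactor a z) • (f z + -c)) := by
    intro z
    rw [map_smul, ← mul_smul, mul_comm, conj_mul_blaschkeFactor ha, one_smul, map_add, map_neg]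
    abel
  simp only [hdec]
  rw [poissonVec_add (hΦ.vec c).toEssBdd (hΦg.blaschkeFactor_smul ha).toEssBdd ha,
    hΦg.poissonVec_blaschkeFactor_smul ha, add_zero]
  rfl

/-- Pettis' theorem through a countable orthonormal basis. It is needed for Φ̃, since taking
adjoints directly preserves only weak measurability. -/
theorem aestronglyMeasurable_of_inner [TopologicalSpace.SeparableSpace E] {f : Circle → E}
    (h : ∀ y, AEStronglyMeasurable (fun z => inner ℂ y (f z)) m) : AEStronglyMeasurable f m := by
  obtain ⟨w, b, hb⟩ := exists_hilbertBasis ℂ E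
  have hcount : Countable w := countable_of_orthonormal (by rw [← hb]; exact b.orthonormal)
  refine aestronglyMeasurable_of_tendsto_ae Filter.atTop
    (f := fun (s : Finset w) (z : Circle) => ∑ i ∈ s, inner ℂ (b i) (f z) • b i)
    (fun s => ?_) (Filter.Eventually.of_forall fun z =>
      hasSum_apply b (ContinuousLinearMap.id ℂ E) (f z))
  exact Finset.aestronglyMeasurable_fun_sum s fun i _ => (h (b i)).smul_const (b i)

theorem ae_inv {p : Circle → Prop} (h : ∀ᵐ z ∂m, p z) : ∀ᵐ z ∂m, p z⁻¹ :=
  measurePreserving_inv.quasiMeasurePreserving.ae h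

theorem inner_tilde_apply (Φ : Circle → D →L[ℂ] E) (z : Circle) (x : D) (y : E) :
    inner ℂ x (tilde Φ z y) = conj (inner ℂ y (Φ z⁻¹ x)) := by
  rw [tilde, ContinuousLinearMap.adjoint_inner_right, inner_conj_symm]

theorem IsHInfty.tilde [TopologicalSpace.SeparableSpace D] {Φ : Circle → D →L[ℂ] E}
    (hΦ : IsHInfty Φ) : IsHInfty (tilde Φ) := by
  obtain ⟨C, hC⟩ := hΦ.bounded
  have hC' : ∀ᵐ z ∂m, ‖OpHardy.tilde Φ z‖ ≤ C := by
    filter_upwards [ae_inv hC] with z hz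
    rwa [OpHardy.tilde, LinearIsometryEquiv.norm_map]
  have hE : ∀ y, EssBdd (fun z => OpHardy.tilde Φ z y) := by
    intro y
    refine ⟨aestronglyMeasurable_of_inner fun x => ?_, C * ‖y‖, ?_⟩
    · simp only [inner_tilde_apply]
      exact Complex.continuous_conj.comp_aestronglyMeasurable
        (((hΦ.vec x).clm (innerSL ℂ y)).measurable.comp_measurePreserving measurePreserving_inv)
    · filter_upwards [hC'] with z hz
      exact (OpHardy.tilde Φ z).le_of_opNorm_le hz y
  refine isHInfty_of_vec hC' fun y => ⟨hE y, fun k => ext_inner_left ℂ fun x => ?_⟩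
  have hint := ((essBdd_pow (k + 1)).smul (hE y)).integrable
  have h0 := congrArg conj (((hΦ.vec x).clm (innerSL ℂ y)).analytic k)
  rw [← integral_conj, map_zero, ← integral_comp_inv] at h0
  rw [inner_zero_right, ← integral_inner hint, ← h0]
  refine integral_congr_ae (Filter.Eventually.of_forall fun z => ?_)
  simp only [inner_smul_right, inner_tilde_apply, innerSL_apply_apply, smul_eq_mul, map_mul, map_pow,
    Circle.coe_inv_eq_conj, RCLike.conj_conj]

theorem poissonKernel_conj (a : ℂ) (z : Circle) :
    poissonKernel 0 (conj a) (z : ℂ) = poissonKernel 0 a ((z⁻¹ : Circle) : ℂ) := by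
  rw [poissonKernel_def, poissonKernel_def, Circle.coe_inv_eq_conj]
  simp only [sub_zero, RCLike.norm_conj]
  rw [← RCLike.norm_conj ((z : ℂ) - conj a), map_sub, RCLike.conj_conj]

/-- This is P[Φ̃](ā) = P[Φ](a)*, written with inner products because `poissonIntegral` is a bare
function: reflecting z reflects the kernel's base point. -/
theorem IsHInfty.inner_poissonIntegral_tilde [TopologicalSpace.SeparableSpace D]
    {Φ : Circle → D →L[ℂ] E} (hΦ : IsHInfty Φ) {a : ℂ} (ha : ‖a‖ < 1) (x : D) (y : E) :
    inner ℂ x (poissonIntegral (OpHardy.tilde Φ) (conj a) y) =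
      inner ℂ (poissonIntegral Φ a x) y := by
  have ha' : ‖conj a‖ < 1 := by simpa using ha
  have h1 := poissonVec_clm (hΦ.tilde.vec y).toEssBdd (innerSL ℂ x) ha'
  have h2 := congrArg conj (poissonVec_clm (hΦ.vec x).toEssBdd (innerSL ℂ y) ha)
  simp only [innerSL_apply_apply] at h1 h2
  rw [inner_conj_symm] at h2
  refine h1.symm.trans (Eq.trans ?_ h2)
  rw [poissonVec_eq, poissonVec_eq, ← integral_conj, ← integral_comp_inv]
  refine integral_congr_ae (Filter.Eventually.of_forall fun z => ?_)
  simp only [inner_tilde_apply, smul_eq_mul, map_mul, Complex.conj_ofReal, poissonKernel_conj,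
    inv_inv]

end Hilbert

theorem conj_blaschkeFactor_inv (a : ℂ) (z : Circle) :
    conj (blaschkeFactor a ((z⁻¹ : Circle) : ℂ)) = blaschkeFactor (conj a) z := by
  simp only [blaschkeFactor, Circle.coe_inv_eq_conj, map_div₀, map_sub, map_mul, map_one,
    RCLike.conj_conj]

theorem isHInftyVec_prod_blaschkeFactor {ι : Type*} (s : Finset ι) (a : ι → ℂ)
    (ha : ∀ i ∈ s, ‖a i‖ < 1) :
    IsHInftyVec (fun z : Circle => ∏ i ∈ s, blaschkeFactor (a i) z) := by
  classical
  induction s using Finset.induction_on with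
  | empty => simpa using isHInftyVec_const (1 : ℂ)
  | insert j s hj ih =>
    simp only [Finset.prod_insert hj]
    exact (ih fun i hi => ha i (Finset.mem_insert_of_mem hi)).blaschkeFactor_smul
      (ha j (Finset.mem_insert_self j s))

/-! ### Injectivity at the zeros implies right coprimeness. -/

section Hilbert

variable {E : Type*} [NormedAddCommGroup E] [InnerProductSpace ℂ E] [CompleteSpace E]

theorem ae_eq_zero_of_integral_zpow {h : Circle → ℂ} (hh : EssBdd h)
    (h0 : ∀ k : ℤ, ∫ z, ((z : Circle) : ℂ) ^ k * h z ∂m = 0) : h =ᵐ[m] 0 := by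
  have h1 := integral_mul_eq_zero (hh.memLp 2) (hh.conj.memLp 2)
    fun k => by rw [h0 k, zero_mul]
  have h2 : ∫ z, ‖h z‖ ^ 2 ∂m = 0 := by
    rw [← Complex.ofReal_inj, ← integral_complex_ofReal, Complex.ofReal_zero, ← h1]
    refine integral_congr_ae (Filter.Eventually.of_forall fun z => ?_)
    simp [Complex.mul_conj, Complex.normSq_eq_norm_sq]
  rw [integral_eq_zero_iff_of_nonneg (fun z => by positivity)
    ((memLp_two_iff_integrable_sq_norm hh.measurable).1 (hh.memLp 2))] at h2
  filter_upwards [h2] with z hz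
  simpa using hz

/-- A function whose nonzero Fourier coefficients vanish is constant. -/
theorem ae_eq_const_of_integral_zpow [TopologicalSpace.SeparableSpace E] {f : Circle → E}
    (hf : IsHInftyVec f) (h : ∀ (y : E) (k : ℕ),
      ∫ z, (z : ℂ) ^ (-(k + 1 : ℕ) : ℤ) * inner ℂ y (f z) ∂m = 0) :
    ∀ᵐ z ∂m, f z = ∫ w, f w ∂m := by
  set c := ∫ w, f w ∂m with hc
  have hconst : ∀ n : ℤ, n ≠ 0 → ∫ z : Circle, (z : ℂ) ^ n ∂m = 0 := by
    intro n hn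
    have h1 := fun n hn => (isHInftyVec_const (1 : ℂ)).integral_zpow_smul (n := n) hn
    simp only [smul_eq_mul, mul_one] at h1
    rcases hn.lt_or_gt with hn | hn
    · rw [← integral_comp_inv, ← h1 (-n) (by omega)]
      simp only [Circle.coe_inv, inv_zpow']
    · exact h1 n hn
  have hbd : EssBdd (fun z => f z + -c) := hf.toEssBdd.add (essBdd_const (-c))
  have hzero : (fun z => f z + -c) =ᵐ[m] 0 := by
    refine ae_eq_zero_of_forall_inner (𝕜 := ℂ) fun y => ?_
    refine ae_eq_zero_of_integral_zpow (hbd.clm (innerSL ℂ y)) fun k => ?_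
    have hz : EssBdd (fun z : Circle => (z : ℂ) ^ k) :=
      essBdd_of_continuous (continuous_circle_coe.zpow₀ k fun z => Or.inl (Circle.coe_ne_zero z))
    have hi1 : Integrable (fun z : Circle => (z : ℂ) ^ k * inner ℂ y (f z)) m :=
      (hz.smul (hf.toEssBdd.clm (innerSL ℂ y))).integrable
    have hi2 : Integrable (fun z : Circle => (z : ℂ) ^ k * inner ℂ y (-c)) m :=
      (hz.smul (essBdd_const (inner ℂ y (-c)))).integrable
    simp only [inner_add_right, mul_add]
    rw [integral_add hi1 hi2, integral_mul_const]
    rcases lt_trichotomy k 0 with hk | rfl | hk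
    · obtain ⟨j, rfl⟩ : ∃ j : ℕ, k = -((j + 1 : ℕ) : ℤ) := ⟨(-k - 1).toNat, by omega⟩
      rw [h y j, hconst _ hk.ne, zero_mul, add_zero]
    · simp only [zpow_zero, one_mul, integral_inner hf.toEssBdd.integrable, ← hc]
      simp
    · have := (hf.clm (innerSL ℂ y)).integral_zpow_smul hk
      simp only [innerSL_apply_apply, smul_eq_mul] at this
      rw [this, hconst k hk.ne', zero_mul, add_zero]
  filter_upwards [hzero] with z hz
  simpa [add_neg_eq_zero] using hz

/-- The null set in `h` depends on `x`; a dense sequence merges these into one, and Δ at any good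
point serves as the constant. -/
theorem isUnitaryConstant_of_forall_ae_eq [TopologicalSpace.SeparableSpace E]
    {Δ : Circle → E →L[ℂ] E} (hU : ∀ᵐ z ∂m, Δ z ∈ unitary (E →L[ℂ] E)) {V : E → E}
    (h : ∀ x, ∀ᵐ z ∂m, Δ z x = V x) : IsUnitaryConstant Δ := by
  have hall : ∀ᵐ z ∂m, ∀ n, Δ z (TopologicalSpace.denseSeq E n) =
      V (TopologicalSpace.denseSeq E n) := ae_all_iff.2 fun n => h _
  obtain ⟨z₀, hz₀, hU₀⟩ := (hall.and hU).exists
  refine ⟨Δ z₀, hU₀, ?_⟩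
  filter_upwards [hall] with z hz
  refine ContinuousLinearMap.coeFn_injective (Continuous.ext_on
    (TopologicalSpace.denseRange_denseSeq E) (Δ z).continuous (Δ z₀).continuous ?_)
  rintro _ ⟨n, rfl⟩
  rw [hz n, hz₀ n]

/-- An inner function whose adjoint is analytic is constant. -/
theorem isUnitaryConstant_of_comp_eq_smul [TopologicalSpace.SeparableSpace E]
    {Δ B : Circle → E →L[ℂ] E} (hΔ : IsHInfty Δ) (hB : IsHInfty B)
    (hU : ∀ᵐ z ∂m, Δ z ∈ unitary (E →L[ℂ] E)) {c : ℂ} (hc : c ≠ 0)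
    (h : ∀ᵐ z ∂m, B z ∘L Δ z = c • ContinuousLinearMap.id ℂ E) : IsUnitaryConstant Δ := by
  refine isUnitaryConstant_of_forall_ae_eq hU (V := fun x => ∫ z, Δ z x ∂m) fun x => ?_
  refine ae_eq_const_of_integral_zpow (hΔ.vec x) fun y k => ?_
  have h1 := congrArg conj (((hB.vec y).clm (innerSL ℂ x)).analytic k)
  rw [map_zero, ← integral_conj] at h1
  have h2 : conj c * ∫ z : Circle, (z : ℂ) ^ (-(k + 1 : ℕ) : ℤ) * inner ℂ y (Δ z x) ∂m = 0 := by
    rw [← integral_const_mul, ← h1]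
    refine integral_congr_ae ?_
    filter_upwards [h, hU] with z hz hUz
    -- Here B = cΔ*, so analyticity of `B` kills the coefficients of Δx of positive index.
    have hBy : B z y = c • ContinuousLinearMap.adjoint (Δ z) y := by
      have h3 : Δ z (ContinuousLinearMap.adjoint (Δ z) y) = y :=
        congrArg (fun T : E →L[ℂ] E => T y) hUz.2
      calc B z y = (B z ∘L Δ z) (ContinuousLinearMap.adjoint (Δ z) y) := by
            rw [ContinuousLinearMap.comp_apply, h3]
        _ = _ := by rw [hz]; rfl
    simp only [innerSL_apply_apply, smul_eq_mul, map_mul, map_pow, hBy, inner_smul_right,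
      ContinuousLinearMap.adjoint_inner_right, inner_conj_symm, ← Circle.coe_inv_eq_conj,
      Circle.coe_inv, zpow_neg, zpow_natCast, inv_pow]
    ring
  exact (mul_eq_zero.1 h2).resolve_left ((map_ne_zero _).2 hc)

/-- Blaschke factors can be removed from `A * Δ = c * ∏ b_{aᵢ}` one at a time, as long as `P[Δ]` has
large range at the points `aᵢ`. -/
theorem exists_comp_eq_smul [TopologicalSpace.SeparableSpace E] {Δ : Circle → E →L[ℂ] E}
    (hΔ : IsHInfty Δ) {ι : Type*} (s : Finset ι) (a : ι → ℂ) (ha : ∀ i ∈ s, ‖a i‖ < 1)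
    -- A substitute for dense range of P[Δ](aᵢ), quantified over every `B` because `A` changes as
    -- factors are removed.
    (hdense : ∀ i ∈ s, ∀ B : Circle → E →L[ℂ] E, IsHInfty B →
      (∀ x, poissonIntegral B (a i) (poissonIntegral Δ (a i) x) = 0) →
      ∀ x, poissonIntegral B (a i) x = 0) (c : ℂ) (A : Circle → E →L[ℂ] E) (hA : IsHInfty A)
    (h : ∀ᵐ z ∂m, A z ∘L Δ z =
      (c * ∏ i ∈ s, blaschkeFactor (a i) (z : ℂ)) • ContinuousLinearMap.id ℂ E) :
    ∃ B : Circle → E →L[ℂ] E, IsHInfty B ∧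
      ∀ᵐ z ∂m, B z ∘L Δ z = c • ContinuousLinearMap.id ℂ E := by
  classical
  induction s using Finset.induction_on generalizing A with
  | empty => exact ⟨A, hA, by simpa using h⟩
  | insert j s hj ih =>
    have haj := ha j (Finset.mem_insert_self j s)
    have has : ∀ i ∈ s, ‖a i‖ < 1 := fun i hi => ha i (Finset.mem_insert_of_mem hi)
    have hPA : ∀ x, poissonIntegral A (a j) x = 0 := by
      refine hdense j (Finset.mem_insert_self j s) A hA fun x => ?_
      rw [show poissonIntegral Δ (a j) x = poissonVec (fun z => Δ z x) (a j) from rfl,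
        ← hA.poissonVec_apply (hΔ.vec x) haj]
      have hv := (isHInftyVec_prod_blaschkeFactor s a has).smul (isHInftyVec_const (c • x))
      rw [← hv.poissonVec_blaschkeFactor_smul haj]
      refine poissonVec_congr ?_ _
      filter_upwards [h] with z hz
      have := congrArg (fun T : E →L[ℂ] E => T x) hz
      simp only [ContinuousLinearMap.comp_apply, smul_apply,
        ContinuousLinearMap.id_apply, Finset.prod_insert hj] at this
      rw [this]
      simp only [← mul_smul]
      congr 1
      ring
    obtain ⟨C, hC⟩ := hA.bounded
    refine ih has (fun i hi => hdense i (Finset.mem_insert_of_mem hi))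
      (fun z => conj (blaschkeFactor (a j) z) • A z) ?_ ?_
    · refine isHInfty_of_vec (C := C) ?_ fun x =>
        (hA.vec x).conj_blaschkeFactor_smul haj (hPA x)
      filter_upwards [hC] with z hz
      rwa [norm_smul, RCLike.norm_conj, norm_blaschkeFactor haj, one_mul]
    · filter_upwards [h] with z hz
      rw [ContinuousLinearMap.smul_comp, hz, ← mul_smul, Finset.prod_insert hj]
      congr 1
      linear_combination (c * ∏ i ∈ s, blaschkeFactor (a i) (z : ℂ)) *
        conj_mul_blaschkeFactor haj z

theorem tilde_scalarFun (θ : ℂ → ℂ) (z : Circle) :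
    tilde (scalarFun E θ) z = conj (θ ((z⁻¹ : Circle) : ℂ)) • ContinuousLinearMap.id ℂ E := by
  rw [tilde, scalarFun, map_smulₛₗ, ContinuousLinearMap.adjoint_id]

theorem tilde_scalarFun_of_blaschke {θ : ℂ → ℂ} {ν : ℂ} {n : ℕ} {a : Fin n → ℂ}
    (hθ : ∀ z : ℂ, ‖z‖ ≤ 1 → θ z = ν * ∏ i, blaschkeFactor (a i) z) (z : Circle) :
    tilde (scalarFun E θ) z =
      (conj ν * ∏ i, blaschkeFactor (conj (a i)) (z : ℂ)) • ContinuousLinearMap.id ℂ E := by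
  rw [tilde_scalarFun, hθ _ (Circle.norm_coe _).le, map_mul, map_prod]
  simp only [conj_blaschkeFactor_inv]

theorem mem_zeroSet_of_blaschke {θ : ℂ → ℂ} {ν : ℂ} {n : ℕ} {a : Fin n → ℂ} (hν : ‖ν‖ = 1)
    (ha : ∀ i, ‖a i‖ < 1) (hθ : ∀ z : ℂ, ‖z‖ ≤ 1 → θ z = ν * ∏ i, blaschkeFactor (a i) z) {α : ℂ} :
    α ∈ zeroSet θ ↔ ∃ i, a i = α := by
  constructor
  · rintro ⟨hα, h0⟩
    rw [hθ α hα.le] at h0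
    have hν0 : ν ≠ 0 := by
      rintro rfl
      simp at hν
    obtain ⟨i, -, hi⟩ := Finset.prod_eq_zero_iff.1 ((mul_eq_zero.1 h0).resolve_left hν0)
    refine ⟨i, ?_⟩
    have hd := one_sub_mul_ne_zero (a := conj (a i)) (by simpa using ha i) hα.le
    rw [blaschkeFactor, div_eq_zero_iff] at hi
    exact (sub_eq_zero.1 (hi.resolve_right hd)).symm
  · rintro ⟨i, rfl⟩
    refine ⟨ha i, ?_⟩
    rw [hθ _ (ha i).le, Finset.prod_eq_zero (Finset.mem_univ i) (by simp [blaschkeFactor]),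
      mul_zero]

/-- A common left inner divisor of `Φ̃` and `θ̃ I` is constant if `P[Φ]` is injective at the zeros of
`θ`. -/
theorem isUnitaryConstant_of_isLeftInnerDivisor [TopologicalSpace.SeparableSpace E]
    {Φ Δ : Circle → E →L[ℂ] E} (hΦ : IsHInfty Φ) {ν : ℂ} (hν : ‖ν‖ = 1) {n : ℕ} {a : Fin n → ℂ}
    (ha : ∀ i, ‖a i‖ < 1) {θ : ℂ → ℂ} (hθ : ∀ z : ℂ, ‖z‖ ≤ 1 → θ z = ν * ∏ i, blaschkeFactor (a i) z)
    (hinj : ∀ i, Function.Injective (poissonIntegral Φ (a i)))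
    (h1 : IsLeftInnerDivisor Δ (tilde Φ)) (h2 : IsLeftInnerDivisor Δ (tilde (scalarFun E θ))) :
    IsUnitaryConstant Δ := by
  obtain ⟨⟨hΔ, hiso⟩, A₁, hA₁, hfac⟩ := h1
  obtain ⟨-, A, hA, hθA⟩ := h2
  have ha' : ∀ i, ‖conj (a i)‖ < 1 := fun i => by simpa using ha i
  have hψ : ∀ z : Circle, conj ν * ∏ i, blaschkeFactor (conj (a i)) (z : ℂ) ≠ 0 := by
    intro z
    rw [← norm_ne_zero_iff, norm_mul, norm_prod, RCLike.norm_conj, hν]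
    simp [norm_blaschkeFactor (ha' _)]
  -- Inner only means isometric; ΔA = ψI with ψ ≠ 0 makes Δ onto, so A = ψΔ* and the factors
  -- commute.
  have hkey : ∀ᵐ z ∂m, Δ z ∈ unitary (E →L[ℂ] E) ∧ A z ∘L Δ z =
      (conj ν * ∏ i, blaschkeFactor (conj (a i)) (z : ℂ)) • ContinuousLinearMap.id ℂ E := by
    filter_upwards [hiso, hθA] with z hz hz'
    rw [tilde_scalarFun_of_blaschke hθ] at hz'
    set ψ := conj ν * ∏ i, blaschkeFactor (conj (a i)) (z : ℂ) with hψdef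
    have hA' : A z = ψ • ContinuousLinearMap.adjoint (Δ z) := by
      calc A z = (ContinuousLinearMap.adjoint (Δ z) ∘L Δ z) ∘L A z := by
            rw [hz, ContinuousLinearMap.id_comp]
        _ = _ := by
            rw [ContinuousLinearMap.comp_assoc, ← hz', ContinuousLinearMap.comp_smul,
              ContinuousLinearMap.comp_id]
    refine ⟨⟨hz, ?_⟩, by rw [hA', ContinuousLinearMap.smul_comp, hz]⟩
    rw [hA', ContinuousLinearMap.comp_smul] at hz'
    exact (smul_right_injective _ (hψ z) hz').symm
  have hν0 : conj ν ≠ 0 := by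
    rw [← norm_ne_zero_iff, RCLike.norm_conj, hν]
    exact one_ne_zero
  have hdense : ∀ i ∈ Finset.univ, ∀ B : Circle → E →L[ℂ] E, IsHInfty B →
      (∀ x, poissonIntegral B (conj (a i)) (poissonIntegral Δ (conj (a i)) x) = 0) →
      ∀ x, poissonIntegral B (conj (a i)) x = 0 := by
    intro i _ B hB h0 x
    have hBt := hB.inner_poissonIntegral_tilde (ha' i)
    simp only [RCLike.conj_conj] at hBt
    rw [← inner_self_eq_zero (𝕜 := ℂ), ← hBt]
    -- With T = P[B](ā), v = T*Tx and ‖Tx‖² = ⟨x, v⟩. Since T P[Φ̃](ā) = 0, taking adjoints gives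
    -- P[Φ](a)v = 0, and injectivity gives v = 0.
    set v := poissonIntegral (tilde B) (a i) (poissonIntegral B (conj (a i)) x) with hv
    have hΦ0 : ∀ y, poissonIntegral B (conj (a i)) (poissonIntegral (tilde Φ) (conj (a i)) y) = 0 := by
      intro y
      rw [← h0 (poissonIntegral A₁ (conj (a i)) y)]
      congr 1
      refine Eq.trans (poissonVec_congr ?_ _) (hΔ.poissonVec_apply (hA₁.vec y) (ha' i))
      filter_upwards [hfac] with z hz
      rw [hz]
      rfl
    have hPv : poissonIntegral Φ (a i) v = 0 := by
      refine ext_inner_right ℂ fun y => ?_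
      rw [← hΦ.inner_poissonIntegral_tilde (ha i), ← inner_conj_symm, hv, hBt, hΦ0]
      simp
    have hP0 : poissonIntegral Φ (a i) 0 = 0 := by
      simp [poissonIntegral]
    rw [hinj i (hPv.trans hP0.symm), inner_zero_right]
  obtain ⟨B, hB, hBΔ⟩ := exists_comp_eq_smul hΔ Finset.univ (fun i => conj (a i))
    (fun i _ => ha' i) hdense (conj ν) A hA (hkey.mono fun z hz => hz.2)
  exact isUnitaryConstant_of_comp_eq_smul hΔ hB (hkey.mono fun z hz => hz.1) hν0 hBΔ

end Hilbert

/-! ### Rank-one Blaschke divisors, for the converse. -/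

section RankOne

variable {E : Type*} [NormedAddCommGroup E] [InnerProductSpace ℂ E]

/-- The orthogonal projection onto the line spanned by a unit vector `u`. -/
noncomputable def lineProj (u : E) : E →L[ℂ] E := (innerSL ℂ u).smulRight u

theorem lineProj_apply (u x : E) : lineProj u x = inner ℂ u x • u := rfl

/-- The operator that multiplies the unit vector `u` by `p` and is the identity on `u`'s orthogonal
complement. -/
noncomputable def lineScale (u : E) (p : ℂ) : E →L[ℂ] E :=
  ContinuousLinearMap.id ℂ E + (p - 1) • lineProj u

theorem lineScale_apply (u : E) (p : ℂ) (x : E) :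
    lineScale u p x = (x - lineProj u x) + p • lineProj u x := by
  change x + (p - 1) • lineProj u x = _
  module

theorem lineScale_one (u : E) : lineScale u 1 = ContinuousLinearMap.id ℂ E := by
  simp [lineScale]

theorem lineScale_comp {u : E} (hu : ‖u‖ = 1) (p q : ℂ) :
    lineScale u p ∘L lineScale u q = lineScale u (p * q) := by
  have huu : inner ℂ u u = (1 : ℂ) := by simp [inner_self_eq_norm_sq_to_K, hu]
  ext x
  simp only [ContinuousLinearMap.comp_apply, lineScale_apply, lineProj_apply, inner_add_right,
    inner_sub_right, inner_smul_right, huu, mul_one, sub_self, zero_add, ← mul_smul]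
  module

theorem norm_lineScale_le (u : E) {p : ℂ} (hp : ‖p‖ = 1) :
    ‖lineScale u p‖ ≤ 1 + 2 * ‖lineProj u‖ := by
  refine (norm_add_le _ _).trans (add_le_add ContinuousLinearMap.norm_id_le ?_)
  rw [norm_smul]
  refine mul_le_mul_of_nonneg_right ((norm_sub_le _ _).trans ?_) (norm_nonneg _)
  rw [hp, norm_one]
  norm_num

variable [CompleteSpace E]

theorem adjoint_lineScale (u : E) (p : ℂ) :
    ContinuousLinearMap.adjoint (lineScale u p) = lineScale u (conj p) := by
  refine ((ContinuousLinearMap.eq_adjoint_iff _ _).2 fun x y => ?_).symm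
  simp only [lineScale_apply, lineProj_apply, inner_add_left, inner_sub_left, inner_add_right,
    inner_sub_right, inner_smul_left, inner_smul_right, RCLike.conj_conj, inner_conj_symm]
  ring

theorem isInner_lineScale {u : E} (hu : ‖u‖ = 1) {a : ℂ} (ha : ‖a‖ < 1) :
    IsInner (fun z : Circle => lineScale u (blaschkeFactor a z)) := by
  refine ⟨isHInfty_of_vec (Filter.Eventually.of_forall fun z =>
    norm_lineScale_le u (norm_blaschkeFactor ha z)) fun x => ?_,
    Filter.Eventually.of_forall fun z => ?_⟩
  · simp only [lineScale_apply]
    exact (isHInftyVec_const _).add ((isHInftyVec_const _).blaschkeFactor_smul ha)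
  · simp only [adjoint_lineScale, lineScale_comp hu, conj_mul_blaschkeFactor ha, lineScale_one]

/-- By `h`, the component of Ψ along `u` vanishes at `a`, so b_a can be divided out of it alone. -/
theorem isNontrivialLeftInnerDivisor_lineScale {u : E} (hu : ‖u‖ = 1) {a : ℂ} (ha : ‖a‖ < 1)
    {Ψ : Circle → E →L[ℂ] E} (hΨ : IsHInfty Ψ) (h : ∀ y, inner ℂ u (poissonIntegral Ψ a y) = 0) :
    IsNontrivialLeftInnerDivisor (fun z : Circle => lineScale u (blaschkeFactor a z)) Ψ := by
  refine ⟨⟨isInner_lineScale hu ha, fun z => lineScale u (conj (blaschkeFactor a z)) ∘L Ψ z, ?_,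
    Filter.Eventually.of_forall fun z => ?_⟩, ?_⟩
  · obtain ⟨C, hC⟩ := hΨ.bounded
    refine isHInfty_of_vec (C := (1 + 2 * ‖lineProj u‖) * C) ?_ fun y => ?_
    · filter_upwards [hC] with z hz
      refine (ContinuousLinearMap.opNorm_comp_le _ _).trans
        (mul_le_mul (norm_lineScale_le u ?_) hz (norm_nonneg _) (by positivity))
      rw [RCLike.norm_conj, norm_blaschkeFactor ha]
    · have hv := (hΨ.vec y).clm (lineProj u)
      have hp : poissonVec (fun z => lineProj u (Ψ z y)) a = 0 := by
        rw [poissonVec_clm (hΨ.vec y).toEssBdd _ ha]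
        exact (congrArg (· • u) (h y)).trans (zero_smul ℂ u)
      simp only [ContinuousLinearMap.comp_apply, lineScale_apply]
      exact ((hΨ.vec y).sub hv).add (hv.conj_blaschkeFactor_smul ha hp)
  · simp only
    rw [← ContinuousLinearMap.comp_assoc, lineScale_comp hu, mul_comm, conj_mul_blaschkeFactor ha,
      lineScale_one, ContinuousLinearMap.id_comp]
  · rintro ⟨V, -, hV⟩
    have huu : lineProj u u = u := by
      rw [lineProj_apply, inner_self_eq_norm_sq_to_K, hu]
      simp
    -- If the divisor were constant, b_a u would be too; its Poisson integral at `a` is 0, yet it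
    -- has norm 1 on the circle.
    have hVu : (fun z : Circle => blaschkeFactor a z • u) =ᵐ[m] fun _ => V u := by
      filter_upwards [hV] with z hz
      rw [← hz, lineScale_apply, huu, sub_self, zero_add]
    have h0 := poissonVec_congr hVu a
    rw [(isHInftyVec_const u).poissonVec_blaschkeFactor_smul ha, poissonVec_const _ ha] at h0
    obtain ⟨z, hz⟩ := hVu.exists
    have h1 : ‖blaschkeFactor a z • u‖ = 1 := by
      rw [norm_smul, norm_blaschkeFactor ha, hu, one_mul]
    have hz' : blaschkeFactor a z • u = 0 := hz.trans h0.symm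
    rw [hz', norm_zero] at h1
    exact zero_ne_one h1

theorem exists_unit_mem_ker_poissonIntegral {Φ : Circle → E →L[ℂ] E} (hΦ : IsHInfty Φ) {a : ℂ}
    (ha : ‖a‖ < 1) (h : ¬ Function.Injective (poissonIntegral Φ a)) :
    ∃ u, ‖u‖ = 1 ∧ poissonIntegral Φ a u = 0 := by
  simp only [Function.Injective, not_forall] at h
  obtain ⟨x, y, hxy, hne⟩ := h
  have hsub : poissonIntegral Φ a (x - y) = 0 := by
    have h1 := poissonVec_add (hΦ.vec (x - y)).toEssBdd (hΦ.vec y).toEssBdd ha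
    simp only [← map_add, sub_add_cancel] at h1
    change poissonIntegral Φ a x = poissonIntegral Φ a (x - y) + poissonIntegral Φ a y at h1
    rwa [hxy, right_eq_add] at h1
  have hn : ‖x - y‖ ≠ 0 := norm_ne_zero_iff.2 (sub_ne_zero.2 hne)
  refine ⟨((‖x - y‖⁻¹ : ℝ) : ℂ) • (x - y), ?_, ?_⟩
  · rw [norm_smul, Complex.norm_real, norm_inv, norm_norm, inv_mul_cancel₀ hn]
  · have h2 := poissonVec_clm (hΦ.vec (x - y)).toEssBdd
      (((‖x - y‖⁻¹ : ℝ) : ℂ) • ContinuousLinearMap.id ℂ E) ha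
    simp only [smul_apply, ContinuousLinearMap.id_apply, ← map_smul] at h2
    refine h2.trans ?_
    rw [show poissonVec (fun z => Φ z (x - y)) a = poissonIntegral Φ a (x - y) from rfl, hsub,
      smul_zero]

theorem isHInfty_scalarFun_tilde_of_blaschke {θ : ℂ → ℂ} {ν : ℂ} {n : ℕ} {a : Fin n → ℂ}
    (ha : ∀ i, ‖a i‖ < 1) (hθ : ∀ z : ℂ, ‖z‖ ≤ 1 → θ z = ν * ∏ i, blaschkeFactor (a i) z) :
    IsHInfty (tilde (scalarFun E θ)) := by
  have ha' : ∀ i, ‖conj (a i)‖ < 1 := fun i => by simpa using ha i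
  refine isHInfty_of_vec (C := ‖ν‖) (Filter.Eventually.of_forall fun z => ?_) fun x => ?_
  · rw [tilde_scalarFun_of_blaschke hθ, norm_smul, norm_mul, norm_prod, RCLike.norm_conj]
    simp only [norm_blaschkeFactor (ha' _), Finset.prod_const_one, mul_one]
    exact mul_le_of_le_one_right (norm_nonneg _) ContinuousLinearMap.norm_id_le
  · simp only [tilde_scalarFun_of_blaschke hθ, smul_apply, ContinuousLinearMap.id_apply,
      mul_comm (conj ν), mul_smul]
    exact (isHInftyVec_prod_blaschkeFactor _ _ fun i _ => ha' i).smul (isHInftyVec_const _)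

theorem poissonIntegral_scalarFun_tilde_of_blaschke {θ : ℂ → ℂ} {ν : ℂ} {n : ℕ} {a : Fin n → ℂ}
    (ha : ∀ i, ‖a i‖ < 1) (hθ : ∀ z : ℂ, ‖z‖ ≤ 1 → θ z = ν * ∏ i, blaschkeFactor (a i) z)
    (i : Fin n) (y : E) : poissonIntegral (tilde (scalarFun E θ)) (conj (a i)) y = 0 := by
  have ha' : ∀ i, ‖conj (a i)‖ < 1 := fun i => by simpa using ha i
  have hv := (isHInftyVec_prod_blaschkeFactor (Finset.univ.erase i) (fun j => conj (a j))
    fun i _ => ha' i).smul (isHInftyVec_const (conj ν • y))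
  refine Eq.trans (poissonVec_congr (Filter.Eventually.of_forall fun z => ?_) _)
    (hv.poissonVec_blaschkeFactor_smul (ha' i))
  simp only [tilde_scalarFun_of_blaschke hθ, smul_apply, ContinuousLinearMap.id_apply, ← mul_smul]
  rw [← Finset.mul_prod_erase Finset.univ _ (Finset.mem_univ i)]
  congr 1
  ring

end RankOne

end OpHardy

theorem corollary4p5 {E : Type*} [NormedAddCommGroup E] [InnerProductSpace ℂ E]
    [CompleteSpace E] [TopologicalSpace.SeparableSpace E]
    (Φ : Circle → E →L[ℂ] E) (hΦ : OpHardy.IsHInfty Φ)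
    (θ : ℂ → ℂ) (hθ : OpHardy.IsFiniteBlaschkeProduct θ) :
    (∀ α ∈ OpHardy.zeroSet θ, Function.Injective (OpHardy.poissonIntegral Φ α)) ↔
      OpHardy.RightCoprime Φ (OpHardy.scalarFun E θ) := by
  open OpHardy in
  obtain ⟨ν, n, a, hν, ha, hθ⟩ := hθ
  constructor
  · rintro h ⟨Δ, h1, h2⟩
    exact h1.2 (isUnitaryConstant_of_isLeftInnerDivisor hΦ hν ha hθ
      (fun i => h _ ((mem_zeroSet_of_blaschke hν ha hθ).2 ⟨i, rfl⟩)) h1.1 h2.1)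
  · intro h α hα
    obtain ⟨i, rfl⟩ := (mem_zeroSet_of_blaschke hν ha hθ).1 hα
    by_contra hinj
    obtain ⟨u, hu, hu0⟩ := exists_unit_mem_ker_poissonIntegral hΦ (ha i) hinj
    have ha' : ‖conj (a i)‖ < 1 := by simpa using ha i
    -- The divisor sits at the conjugate of `a i`, where P[Φ̃] is the adjoint of P[Φ](aᵢ), so its
    -- range is orthogonal to `u`; P[Θ̃] vanishes there.
    refine h ⟨_, isNontrivialLeftInnerDivisor_lineScale hu ha' hΦ.tilde fun y => ?_,
      isNontrivialLeftInnerDivisor_lineScale hu ha'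
        (isHInfty_scalarFun_tilde_of_blaschke ha hθ) fun y => ?_⟩
    · rw [hΦ.inner_poissonIntegral_tilde (ha i), hu0, inner_zero_left]
    · rw [poissonIntegral_scalarFun_tilde_of_blaschke ha hθ, inner_zero_right]
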